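/- For a commutative ring $R$ and a finite unital associative $R$-algebra $A$, let $\mathrm{g}_2(A,R)$ denote the number of ordered pairs $(a_1,a_2)\in A^2$ which generate $A$ as a unital $R$-algebra. For any positive integers $n,r,t$ with $n\neq 2$ there is a constant $c(n,r,t)$ such that $$\mathrm{g}_2\bigl(\mathrm{M}_n(\mathbb F_{q^r})^t,\mathbb F_q\bigr)\;\ge\; q^{2n^2rt}\left(1-\frac{25t}{q^2}\right)^t$$ for all prime powers $q\ge c(n,r,t)$. Here $\mathrm{M}_n(\mathbb F_{q^r})^t$ is the direct product of $t$ copies of the ring of $n\times n$ matrices over the field $\mathbb F_{q^r}$ with $q^r$ elements, regarded as an algebra over its subfield $\mathbb F_q$ with $q$ elements. -/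

import Mathlib

/-- The number of `k`-tuples of elements of the (finite) `R`-algebra `A` which generate `A`
as a unital `R`-algebra. -/
noncomputable def numGen (k : ℕ) (R A : Type*) [CommRing R] [Ring A] [Algebra R A] : ℕ :=
  Nat.card {a : Fin k → A // Algebra.adjoin R (Set.range a) = ⊤}

open Module

/-! Write F, K for the fields with q and Q = q^r elements. A pair in M_n(K)^t is a t-tuple of pairs
in M_n(K). By `adjoin_eq_top_of_trace` it generates over F as soon as each coordinate generates
M_n(K) over K and all Galois conjugates of all the trace vectors are distinct: after extending
scalars to K, the algebra M_n(K)^t becomes a product of t·r matrix algebras, and a generated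
subalgebra can only fall short by identifying two factors, which would force equal traces.

It remains to count such tuples. A pair that does not generate M_n(K) preserves a proper nonzero
subspace or commutes with a nonscalar endomorphism having irreducible minimal polynomial. For n ≥ 3
these conditions have codimension at least 2, so at most 7Q^(2n²)/q² pairs are lost; for n = 1 none
are. For n = 2 invariant lines have codimension only 1, whence the exclusion. Trace vectors with
nontrivial Galois stabilizer cost at most Q^(2n²)/q², and so does avoiding the Galois orbit of one
given trace vector. Choosing the coordinates greedily (`pow_le_ncard_pairwise_not`) gives the t-th
power. -/

/-! ### Chinese remainder theorem for simple quotients. -/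

theorem exists_map_eq_zero_map_eq_one_of_not_le {R A B : Type*} [Ring R] [Ring A] [Ring B]
    [IsSimpleRing B] (f : R →+* A) (g : R →+* B) (hg : Function.Surjective g)
    (h : ¬ RingHom.ker f ≤ RingHom.ker g) : ∃ x, f x = 0 ∧ g x = 1 := by
  obtain ⟨x, hx, hx'⟩ := SetLike.not_le_iff_exists.1 h
  -- The image of ker f under the surjection g is a two-sided ideal of B; it is nonzero, so it
  -- contains 1.
  let I : TwoSidedIdeal B := TwoSidedIdeal.mk' (g '' {y | f y = 0})
    ⟨0, map_zero f, map_zero g⟩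
    (by rintro _ _ ⟨a, ha, rfl⟩ ⟨b, hb, rfl⟩
        exact ⟨a + b, by simp_all, map_add _ _ _⟩)
    (by rintro _ ⟨a, ha, rfl⟩
        exact ⟨-a, by simp_all, map_neg _ _⟩)
    (by rintro z _ ⟨a, ha, rfl⟩
        obtain ⟨z, rfl⟩ := hg z
        exact ⟨z * a, by simp_all, map_mul _ _ _⟩)
    (by rintro _ z ⟨a, ha, rfl⟩
        obtain ⟨z, rfl⟩ := hg z
        exact ⟨a * z, by simp_all, map_mul _ _ _⟩)
  have hmem : ∀ y, y ∈ I ↔ y ∈ g '' {y | f y = 0} := fun y => TwoSidedIdeal.mem_mk' ..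
  exact (hmem _).1 (IsSimpleRing.one_mem_of_ne_zero_mem I (x := g x) hx' ((hmem _).2 ⟨x, hx, rfl⟩))

/-- If two surjections of a ring onto simple rings have different kernels, then some element
dies in the first and is sent to `1` by the second. -/
theorem exists_map_eq_zero_map_eq_one {R A B : Type*} [Ring R] [Ring A] [Ring B]
    [IsSimpleRing A] [IsSimpleRing B] (f : R →+* A) (g : R →+* B)
    (hf : Function.Surjective f) (hg : Function.Surjective g)
    (h : RingHom.ker f ≠ RingHom.ker g) : ∃ x, f x = 0 ∧ g x = 1 := by
  by_cases hle : RingHom.ker f ≤ RingHom.ker g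
  · obtain ⟨x, hx, hx'⟩ := exists_map_eq_zero_map_eq_one_of_not_le g f hf
      (fun h' => h (le_antisymm hle h'))
    exact ⟨1 - x, by simp [hx'], by simp [hx]⟩
  · exact exists_map_eq_zero_map_eq_one_of_not_le f g hg hle

/-- Chinese remainder theorem for surjections onto simple rings with distinct kernels. -/
theorem pi_surjective_of_ker_injective {R ι : Type*} [Ring R] [Finite ι] {A : ι → Type*}
    [∀ i, Ring (A i)] [∀ i, IsSimpleRing (A i)] (f : ∀ i, R →+* A i)
    (hf : ∀ i, Function.Surjective (f i))
    (hker : Function.Injective fun i => RingHom.ker (f i)) :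
    Function.Surjective (RingHom.pi f) := by
  classical
  have := Fintype.ofFinite ι
  have hsep : ∀ j, ∀ s : Finset ι, j ∉ s → ∃ x, f j x = 1 ∧ ∀ i ∈ s, f i x = 0 := by
    intro j s
    induction s using Finset.induction_on with
    | empty => exact fun _ => ⟨1, by simp⟩
    | insert i s his ih =>
      intro hj
      obtain ⟨x, hx, hx'⟩ := ih (fun h => hj (Finset.mem_insert_of_mem h))
      obtain ⟨y, hy, hy'⟩ := exists_map_eq_zero_map_eq_one (f i) (f j) (hf i) (hf j)
        (fun h => hj (by rw [hker h]; exact Finset.mem_insert_self _ _))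
      refine ⟨x * y, by simp [hx, hy'], fun k hk => ?_⟩
      rcases Finset.mem_insert.1 hk with rfl | hk
      · simp [hy]
      · simp [hx' k hk]
  choose z hz hz' using fun j => hsep j (Finset.univ.erase j) (by simp)
  intro y
  choose x hx using fun i => hf i (y i)
  refine ⟨∑ j, x j * z j, funext fun i => ?_⟩
  simp only [RingHom.pi_apply, map_sum, map_mul]
  rw [Finset.sum_eq_single i]
  · simp [hz, hx]
  · intro j _ hj
    rw [hz' j i (by simp [hj.symm]), mul_zero]
  · simp

/-! ### Trace criterion for generation over the smaller field. -/

/-- Surjections of a `K`-algebra onto a matrix ring with the same kernel have the same traces. -/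
theorem trace_eq_of_ker_eq {K R ι : Type*} [Field K] [Ring R] [Algebra K R] [Fintype ι]
    [DecidableEq ι] (f g : R →ₐ[K] Matrix ι ι K) (hf : Function.Surjective f)
    (h : RingHom.ker f.toRingHom = RingHom.ker g.toRingHom) (x : R) :
    (f x).trace = (g x).trace := by
  have hle : RingHom.ker f ≤ RingHom.ker g := h.le
  let e := Ideal.Quotient.liftₐ (RingHom.ker f) g (fun a ha => hle ha)
  let ef := Ideal.quotientKerAlgEquivOfSurjective hf
  have hfx : f x = ef (Ideal.Quotient.mk _ x) := rfl
  have hgx : g x = (e.comp ef.symm.toAlgHom) (f x) := by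
    rw [hfx]
    simp [e]
    rfl
  -- g is f followed by a K-algebra endomorphism of the matrix algebra, and such endomorphisms
  -- preserve the trace.
  rw [hgx, Matrix.trace_map']

theorem finrank_span_le_finrank {F K V : Type*} [Field F] [Field K] [Algebra F K] [AddCommGroup V]
    [Module F V] [Module K V] [IsScalarTower F K V] (W : Submodule F V) [FiniteDimensional F W] :
    finrank K (Submodule.span K (W : Set V)) ≤ finrank F W := by
  classical
  let b := finBasis F W
  have hspan : Submodule.span K (W : Set V) = Submodule.span K (Set.range fun i => (b i : V)) := by
    apply le_antisymm
    · rw [Submodule.span_le]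
      intro w hw
      have := b.sum_repr ⟨w, hw⟩
      have h2 : w = ∑ i, b.repr ⟨w, hw⟩ i • (b i : V) := by
        have h3 := congrArg W.subtype this
        rw [map_sum] at h3
        exact h3.symm
      rw [h2]
      refine Submodule.sum_mem _ fun i _ => ?_
      rw [← algebraMap_smul K]
      exact Submodule.smul_mem _ _ (Submodule.subset_span ⟨i, rfl⟩)
    · exact Submodule.span_mono (by rintro _ ⟨i, rfl⟩; exact (b i).2)
  rw [hspan]
  exact (finrank_range_le_card (R := K) (fun i => (b i : V))).trans (by simp)

open scoped Classical in
/-- If each coordinate of a family in `M_n(K)^t` generates `M_n(K)` over `K`, and the Galois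
conjugates of the trace vectors of the coordinates are pairwise distinct, then the family
generates `M_n(K)^t` over `F`. -/
theorem adjoin_eq_top_of_trace {F K κ : Type*} [Field F] [Field K] [Algebra F K] [Finite K]
    {n t : ℕ} [NeZero n] (x : κ → Fin t → Matrix (Fin n) (Fin n) K)
    (hgen : ∀ s, Algebra.adjoin K (Set.range fun i => x i s) = ⊤)
    (htr : Function.Injective fun (p : Fin t × (K ≃ₐ[F] K)) (i : κ) => p.2 (x i p.1).trace) :
    Algebra.adjoin F (Set.range x) = ⊤ := by
  let M := Matrix (Fin n) (Fin n) K
  let P := Fin t × (K ≃ₐ[F] K)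
  have : Finite F := Finite.of_injective _ (algebraMap F K).injective
  have : Fintype (K ≃ₐ[F] K) := Fintype.ofFinite _
  let tw : (K ≃ₐ[F] K) → M →ₐ[F] M := fun τ => (τ : K →ₐ[F] K).mapMatrix
  have htw : ∀ τ m, tw τ m = m.map τ := fun τ m => rfl
  -- θ lists all Galois twists of all coordinates; it plays the role of the embedding of M^t in its
  -- scalar extension to K.
  let θ : (Fin t → M) →ₐ[F] (P → M) :=
    AlgHom.pi (fun p : P => (tw p.2).comp (Pi.evalAlgHom F (fun _ : Fin t => M) p.1))
  have hθ : ∀ y p, θ y p = (y p.1).map p.2 := fun y p => rfl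
  have hθinj : Function.Injective θ := by
    intro y z h
    ext s i j
    have := congrFun h (s, 1)
    simpa [hθ] using congrFun (congrFun this i) j
  let φ : P → FreeAlgebra K κ →ₐ[K] M := fun p => FreeAlgebra.lift K fun i => θ (x i) p
  have hφ : ∀ p i, φ p (FreeAlgebra.ι K i) = (x i p.1).map p.2 := by
    intro p i
    simp [φ, hθ]
  have hφsurj : ∀ p, Function.Surjective (φ p) := by
    intro p
    rw [← AlgHom.range_eq_top, eq_top_iff]
    intro m _
    -- The entrywise twist is only semilinear over K, but it sends scalars to scalars, so it maps
    -- the K-algebra generated by the `x i p.1` into the range of `φ p`.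
    have key : ∀ m ∈ Algebra.adjoin K (Set.range fun i => x i p.1), tw p.2 m ∈ (φ p).range := by
      intro m hm
      induction hm using Algebra.adjoin_induction with
      | mem m hm =>
        obtain ⟨i, rfl⟩ := hm
        exact ⟨FreeAlgebra.ι K i, hφ p i⟩
      | algebraMap k =>
        have : tw p.2 (algebraMap K M k) = algebraMap K M (p.2 k) := by
          simp [htw, Matrix.algebraMap_eq_diagonal, Matrix.diagonal_map, M]
        rw [this]
        exact Subalgebra.algebraMap_mem _ _
      | add a b _ _ ha hb => rw [map_add]; exact add_mem ha hb
      | mul a b _ _ ha hb => rw [map_mul]; exact mul_mem ha hb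
    have := key (m.map p.2.symm) (by rw [hgen]; trivial)
    rw [htw] at this
    convert this
    ext i j
    simp
  have hker : Function.Injective fun p => RingHom.ker (φ p).toRingHom := by
    intro p p' h
    apply htr
    funext i
    have := trace_eq_of_ker_eq (φ p) (φ p') (hφsurj p) h (FreeAlgebra.ι K i)
    rw [hφ, hφ] at this
    have htrace : ∀ (τ : K ≃ₐ[F] K) (m : M), (m.map τ).trace = τ m.trace := by
      intro τ m
      simp [Matrix.trace]
    simpa [htrace] using this
  have hsurj := pi_surjective_of_ker_injective (fun p => (φ p).toRingHom) hφsurj hker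
  set B := Algebra.adjoin F (Set.range x) with hB
  let C : Subalgebra F (P → M) := B.map θ
  have hC : Algebra.adjoin K (C : Set (P → M)) = ⊤ := by
    rw [eq_top_iff]
    have h1 : (AlgHom.pi φ).range ≤ Algebra.adjoin K (C : Set (P → M)) := by
      have h2 : AlgHom.pi φ = FreeAlgebra.lift K fun i => θ (x i) := by
        ext i : 2
        funext p
        simp [φ]
      rw [h2, ← Algebra.adjoin_range_eq_range_freeAlgebra_lift]
      apply Algebra.adjoin_mono
      rintro _ ⟨i, rfl⟩
      exact ⟨x i, Algebra.subset_adjoin ⟨i, rfl⟩, rfl⟩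
    refine le_trans ?_ h1
    intro y _
    obtain ⟨z, hz⟩ := hsurj y
    exact ⟨z, hz⟩
  have hspan : Submodule.span K ((Subalgebra.toSubmodule C : Submodule F (P → M)) : Set (P → M))
      = ⊤ := by
    have h1 := Algebra.adjoin_eq_span K (C : Set (P → M))
    have h2 : (Submonoid.closure (C : Set (P → M)) : Set (P → M)) = C :=
      congrArg SetLike.coe (Submonoid.closure_eq C.toSubmonoid)
    rw [h2, hC] at h1
    exact h1.symm
  -- Since `C` spans over K, dim_F B = dim_F C ≥ dim_K M^P = t[K:F]n² = dim_F M^t. Here P has t[K:F]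
  -- elements because extensions of finite fields are Galois.
  have hle := finrank_span_le_finrank (K := K) (Subalgebra.toSubmodule C)
  rw [hspan, finrank_top, Subalgebra.finrank_toSubmodule] at hle
  have hCB : finrank F C = finrank F B :=
    (LinearEquiv.finrank_eq (Subalgebra.equivMapOfInjective B θ hθinj).toLinearEquiv).symm
  have hP : finrank K (P → M) = t * finrank F K * (n * n) := by
    rw [Module.finrank_pi_fintype]
    simp [P, M, Module.finrank_matrix, ← IsGalois.card_aut_eq_finrank F K]
  have hM : finrank F (Fin t → M) = t * finrank F K * (n * n) := by
    rw [Module.finrank_pi_fintype]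
    simp only [M, Module.finrank_matrix]
    simp
    ring
  rw [hP, hCB, ← hM] at hle
  apply Subalgebra.toSubmodule_injective
  rw [Algebra.top_toSubmodule]
  apply Submodule.eq_top_of_finrank_eq
  exact le_antisymm (Submodule.finrank_le _) hle

/-! ### Obstructions to generating a full endomorphism algebra. -/

theorem exists_finset_linearIndepOn_span_eq_top {K V ι : Type*} [DivisionRing K] [AddCommGroup V]
    [Module K V] [Finite ι] (v : ι → V) (hv : Submodule.span K (Set.range v) = ⊤) :
    ∃ I : Finset ι, LinearIndepOn K v (I : Set ι) ∧ Submodule.span K (v '' I) = ⊤ := by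
  obtain ⟨b, -, -, hb, hli⟩ := exists_linearIndepOn_extension (linearIndepOn_empty K v)
    (Set.empty_subset Set.univ)
  refine ⟨b.toFinite.toFinset, by simpa using hli, ?_⟩
  rw [eq_top_iff, ← hv, Submodule.span_le]
  simpa using hb

/-- Burnside's argument. If V is simple over the generated algebra S, then End_S V is a division
ring. When it consists of scalars, every K-linear map commutes with it, and Jacobson density puts
that map in S. Otherwise a nonscalar element has irreducible minimal polynomial of degree at least
2. -/
theorem exists_invariant_or_commute {K V : Type*} [Field K] [AddCommGroup V] [Module K V]
    [FiniteDimensional K V] [Nontrivial V] (s : Set (Module.End K V))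
    (hs : Algebra.adjoin K s ≠ ⊤) :
    (∃ W : Submodule K V, W ≠ ⊥ ∧ W ≠ ⊤ ∧ ∀ f ∈ s, ∀ w ∈ W, f w ∈ W) ∨
    ∃ c : Module.End K V, (∀ f ∈ s, Commute c f) ∧ Irreducible (minpoly K c) ∧
      2 ≤ (minpoly K c).natDegree := by
  classical
  set S := Algebra.adjoin K s with hS
  by_cases hsimple : IsSimpleModule S V
  · right
    let ρ : Module.End S V →ₐ[K] Module.End K V :=
      AlgHom.ofLinearMap
        { toFun := fun f => f.restrictScalars K
          map_add' := fun _ _ => rfl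
          map_smul' := fun _ _ => rfl } rfl (fun _ _ => rfl)
    have : IsDomain (Module.End S V) :=
      @DivisionRing.isDomain _ (Module.End.instDivisionRing (R := S) (M := V))
    have hρ : Function.Injective ρ := LinearMap.restrictScalars_injective K
    by_cases hall : ∀ d : Module.End S V, ∃ k : K, ∀ v, d v = k • v
    · exfalso
      apply hs
      rw [eq_top_iff]
      intro f _
      let f' : Module.End (Module.End S V) V :=
        { toFun := f
          map_add' := f.map_add
          map_smul' := by
            intro d v
            obtain ⟨k, hk⟩ := hall d
            simp [hk] }
      let b := finBasis K V
      obtain ⟨r, hr⟩ := jacobson_density f' (Finset.univ.image b)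
      have : f = r := b.ext fun i => hr (b i) (by simp)
      rw [this]
      exact r.2
    · push Not at hall
      obtain ⟨d, hd⟩ := hall
      have hint : IsIntegral K d := (isIntegral_algHom_iff ρ hρ).1 (Algebra.IsIntegral.isIntegral _)
      refine ⟨ρ d, fun f hf => ?_, ?_, ?_⟩
      · ext v
        exact d.map_smul (⟨f, Algebra.subset_adjoin hf⟩ : S) v
      · rw [minpoly.algHom_eq ρ hρ]
        exact minpoly.irreducible hint
      · rw [minpoly.algHom_eq ρ hρ, minpoly.two_le_natDegree_iff hint]
        rintro ⟨k, rfl⟩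
        obtain ⟨v, hv⟩ := hd k
        exact hv (by simp [Module.algebraMap_end_apply])
  · left
    rw [isSimpleModule_iff] at hsimple
    by_contra! hcon
    apply hsimple
    have : Nontrivial (Submodule S V) := inferInstance
    refine { eq_bot_or_eq_top := fun N => ?_ }
    by_contra! hN
    obtain ⟨f, hf, w, hw, hfw⟩ := hcon (N.restrictScalars K) (by simpa using hN.1) (by simpa using hN.2)
    exact hfw (N.smul_mem (⟨f, Algebra.subset_adjoin hf⟩ : S) hw)

/-- As `minpoly K c` is irreducible, K[c] is a field and V a vector space over it; I indexes a
K[c]-basis extracted from the family v. -/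
theorem exists_finset_span_aeval {K V ι : Type*} [Field K] [AddCommGroup V] [Module K V]
    [FiniteDimensional K V] [Finite ι] (v : ι → V) (hv : Submodule.span K (Set.range v) = ⊤)
    (c : Module.End K V) (hc : Irreducible (minpoly K c)) :
    ∃ I : Finset ι, I.card * (minpoly K c).natDegree = finrank K V ∧
      Submodule.span K {w | ∃ i ∈ I, ∃ p : Polynomial K, w = Polynomial.aeval c p (v i)} = ⊤ := by
  have : Fact (Irreducible (minpoly K c)) := ⟨hc⟩
  let E := AdjoinRoot (minpoly K c)
  let φ : E →ₐ[K] Module.End K V :=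
    Ideal.Quotient.liftₐ (Ideal.span {minpoly K c}) (Polynomial.aeval c) (fun p hp => by
      obtain ⟨q, rfl⟩ := Ideal.mem_span_singleton.1 hp
      rw [map_mul, minpoly.aeval, zero_mul])
  have hφ : ∀ p, φ (AdjoinRoot.mk _ p) = Polynomial.aeval c p := fun _ => rfl
  let inst : Module E V := Module.compHom V φ.toRingHom
  have hsmul : ∀ (e : E) (w : V), e • w = φ e w := fun _ _ => rfl
  have : IsScalarTower K E V := ⟨fun k e w => by simp [hsmul]⟩
  obtain ⟨I, hli, hspan⟩ := exists_finset_linearIndepOn_span_eq_top (K := E) v (by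
    rw [eq_top_iff]
    intro w _
    have hw : w ∈ Submodule.span K (Set.range v) := by rw [hv]; trivial
    exact Submodule.span_le_restrictScalars K E _ hw)
  refine ⟨I, ?_, ?_⟩
  · have hb : finrank E V = I.card := by
      have hspan' : Submodule.span E (Set.range fun i : (I : Set ι) => v i) = ⊤ := by
        rw [← hspan, Set.image_eq_range]
      have := finrank_eq_card_basis (Basis.mk hli hspan'.ge)
      simpa using this
    rw [← hb, ← finrank_mul_finrank K E V, mul_comm,
      (AdjoinRoot.powerBasis hc.ne_zero).finrank, AdjoinRoot.powerBasis_dim]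
  · rw [eq_top_iff]
    intro w _
    have hw : w ∈ Submodule.span E (v '' I) := by rw [hspan]; trivial
    induction hw using Submodule.span_induction with
    | mem w hw =>
      obtain ⟨i, hi, rfl⟩ := hw
      exact Submodule.subset_span ⟨i, hi, 1, by simp⟩
    | zero => exact zero_mem _
    | add a b _ _ ha hb => exact add_mem (ha trivial) (hb trivial)
    | smul e a _ ha =>
      replace ha := ha trivial
      clear * - hsmul hφ ha
      rw [hsmul]
      induction ha using Submodule.span_induction with
      | mem w hw =>
        obtain ⟨i, hi, p, rfl⟩ := hw
        obtain ⟨q, rfl⟩ := AdjoinRoot.mk_surjective e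
        refine Submodule.subset_span ⟨i, hi, q * p, ?_⟩
        rw [hφ, map_mul, Module.End.mul_apply]
      | zero => rw [map_zero]; exact zero_mem _
      | add a b _ _ ha hb => rw [map_add]; exact add_mem ha hb
      | smul e a _ ha => rw [map_smul]; exact Submodule.smul_mem _ _ ha

/-! ### Counting pairs with a common invariant subspace. -/

/-- I is chosen so that the e_i with i ∈ I map to a basis of the quotient by W. Then W is
complementary to their span, hence the graph of a linear map into it. -/
theorem exists_finset_graph {K : Type*} [Field K] {n : ℕ} (W : Submodule K (Fin n → K))
    (hbot : W ≠ ⊥) (htop : W ≠ ⊤) :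
    ∃ I : Finset (Fin n), I.Nonempty ∧ I ≠ Finset.univ ∧
      (∀ w ∈ W, (∀ l ∉ I, w l = 0) → w = 0) ∧
      ∀ j ∉ I, ∃ y : Fin n → K, (∀ l ∉ I, y l = 0) ∧ Pi.single j 1 + y ∈ W := by
  classical
  let e : Fin n → (Fin n → K) := fun i => Pi.single i 1
  have hsum : ∀ w : Fin n → K, w = ∑ i, w i • e i := fun w => by
    ext j; simp [e, Finset.sum_apply, Pi.single_apply]
  have hspan : Submodule.span K (Set.range fun i => W.mkQ (e i)) = ⊤ := by
    rw [eq_top_iff]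
    intro w _
    obtain ⟨w, rfl⟩ := W.mkQ_surjective w
    rw [hsum w, map_sum]
    refine Submodule.sum_mem _ fun i _ => ?_
    rw [map_smul]
    exact Submodule.smul_mem _ _ (Submodule.subset_span ⟨i, rfl⟩)
  obtain ⟨I, hli, hI⟩ := exists_finset_linearIndepOn_span_eq_top _ hspan
  have h1 : ∀ w ∈ W, (∀ l ∉ I, w l = 0) → w = 0 := by
    intro w hw h0
    have hz : ∑ i ∈ I, w i • W.mkQ (e i) = 0 := by
      rw [Finset.sum_subset (Finset.subset_univ I) (fun i _ hi => by rw [h0 i hi, zero_smul])]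
      have := congrArg W.mkQ (hsum w)
      rw [map_sum] at this
      simp only [map_smul] at this
      rw [← this]
      simpa using hw
    have := linearIndepOn_finset_iff.1 hli w hz
    ext l
    by_cases hl : l ∈ I
    · exact this l hl
    · exact h0 l hl
  have h2 : ∀ j, ∃ y : Fin n → K, (∀ l ∉ I, y l = 0) ∧ Pi.single j 1 + y ∈ W := by
    intro j
    have hj : W.mkQ (e j) ∈ Submodule.span K ((fun i => W.mkQ (e i)) '' I) := by rw [hI]; trivial
    obtain ⟨f, hfj⟩ := (Submodule.mem_span_image_finset_iff_exists_fun' K).1 hj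
    refine ⟨-∑ i ∈ I, f i • e i, fun l hl => ?_, ?_⟩
    · simp only [Pi.neg_apply, Finset.sum_apply, neg_eq_zero]
      refine Finset.sum_eq_zero fun i hi => ?_
      have : l ≠ i := fun h => hl (h ▸ hi)
      simp [e, this]
    · rw [← sub_eq_add_neg, ← Submodule.Quotient.mk_eq_zero, ← Submodule.mkQ_apply, map_sub,
        map_sum]
      simp only [map_smul]
      rw [sub_eq_zero]
      exact hfj.symm
  refine ⟨I, ?_, ?_, h1, fun j _ => h2 j⟩
  · rw [Finset.nonempty_iff_ne_empty]
    rintro rfl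
    apply htop
    rw [eq_top_iff]
    intro w _
    rw [hsum w]
    refine Submodule.sum_mem _ fun i _ => Submodule.smul_mem _ _ ?_
    obtain ⟨y, hy, hy'⟩ := h2 i
    have : y = 0 := funext fun l => hy l (by simp)
    simpa [this] using hy'
  · rintro rfl
    apply hbot
    rw [eq_bot_iff]
    intro w hw
    exact h1 w hw (by simp)

/-- The vectors `e_j + ∑_{i ∈ I} Y_{ij} e_i` for `j ∉ I`, and `e_j` for `j ∈ I`. -/
def graphVec {K : Type*} [Field K] {n : ℕ} (I : Finset (Fin n))
    (Y : {p : Fin n × Fin n // p.1 ∈ I ∧ p.2 ∉ I} → K) (j : Fin n) : Fin n → K :=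
  fun i => if i = j then 1 else if h : i ∈ I ∧ j ∉ I then Y ⟨(i, j), h⟩ else 0

theorem graphVec_of_mem {K : Type*} [Field K] {n : ℕ} {I : Finset (Fin n)}
    (Y : {p : Fin n × Fin n // p.1 ∈ I ∧ p.2 ∉ I} → K) {j : Fin n} (hj : j ∈ I) :
    graphVec I Y j = Pi.single j 1 := by
  ext i
  simp [graphVec, hj, Pi.single_apply]

theorem graphVec_apply_of_notMem {K : Type*} [Field K] {n : ℕ} {I : Finset (Fin n)}
    (Y : {p : Fin n × Fin n // p.1 ∈ I ∧ p.2 ∉ I} → K) (j : Fin n) {l : Fin n} (hl : l ∉ I) :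
    graphVec I Y j l = if l = j then 1 else 0 := by
  simp [graphVec, hl]

theorem span_graphVec {K : Type*} [Field K] {n : ℕ} (I : Finset (Fin n))
    (Y : {p : Fin n × Fin n // p.1 ∈ I ∧ p.2 ∉ I} → K) :
    Submodule.span K (Set.range (graphVec I Y)) = ⊤ := by
  classical
  set W := Submodule.span K (Set.range (graphVec I Y)) with hW
  have hmem : ∀ j, graphVec I Y j ∈ W := fun j => Submodule.subset_span ⟨j, rfl⟩
  have h1 : ∀ w : Fin n → K, (∀ l ∉ I, w l = 0) → w ∈ W := by
    intro w hw
    rw [pi_eq_sum_univ' w]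
    refine Submodule.sum_mem _ fun i _ => ?_
    by_cases hi : i ∈ I
    · convert Submodule.smul_mem _ (w i) (hmem i)
      exact (graphVec_of_mem Y hi).symm
    · simp [hw i hi]
  rw [eq_top_iff]
  intro v _
  have h2 : v - ∑ l ∈ Iᶜ, v l • graphVec I Y l ∈ W := by
    apply h1
    intro l hl
    simp [Finset.sum_apply, graphVec_apply_of_notMem Y _ hl, hl]
  have h3 : ∑ l ∈ Iᶜ, v l • graphVec I Y l ∈ W :=
    Submodule.sum_mem _ fun l _ => Submodule.smul_mem _ _ (hmem l)
  simpa using add_mem h2 h3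

/-- Pairs of matrices with a common invariant subspace complementary to the span of the
standard basis vectors indexed by `I`. -/
def reducibleSet (K : Type*) [Field K] {n : ℕ} (I : Finset (Fin n)) :
    Set (Fin 2 → Matrix (Fin n) (Fin n) K) :=
  {x | ∃ Y, ∀ i, ∀ j ∉ I, (x i).mulVec (graphVec I Y j) =
    ∑ l ∈ Iᶜ, (x i).mulVec (graphVec I Y j) l • graphVec I Y l}

theorem mem_reducibleSet_of_invariant {K : Type*} [Field K] {n : ℕ}
    {x : Fin 2 → Matrix (Fin n) (Fin n) K} {W : Submodule K (Fin n → K)} (hbot : W ≠ ⊥)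
    (htop : W ≠ ⊤) (hx : ∀ i, ∀ w ∈ W, (x i).mulVec w ∈ W) :
    ∃ I : Finset (Fin n), I.Nonempty ∧ I ≠ Finset.univ ∧ x ∈ reducibleSet K I := by
  classical
  obtain ⟨I, hI, hI', hW, hy⟩ := exists_finset_graph W hbot htop
  refine ⟨I, hI, hI', ?_⟩
  choose y hy0 hyW using hy
  let Y : {p : Fin n × Fin n // p.1 ∈ I ∧ p.2 ∉ I} → K := fun p => y p.1.2 p.2.2 p.1.1
  have hg : ∀ j (hj : j ∉ I), graphVec I Y j ∈ W := by
    intro j hj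
    convert hyW j hj
    ext i
    by_cases hi : i ∈ I
    · have : i ≠ j := fun h => hj (h ▸ hi)
      simp [graphVec, this, hi, hj, Y]
    · simp [graphVec_apply_of_notMem Y j hi, hy0 j hj i hi, Pi.single_apply]
  refine ⟨Y, fun i j hj => ?_⟩
  set v := (x i).mulVec (graphVec I Y j)
  rw [← sub_eq_zero]
  apply hW
  · exact sub_mem (hx i _ (hg j hj)) (Submodule.sum_mem _ fun l hl =>
      Submodule.smul_mem _ _ (hg l (Finset.mem_compl.1 hl)))
  · intro l hl
    simp [Finset.sum_apply, graphVec_apply_of_notMem Y _ hl, hl]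

/-- With k = |I|, the subspace costs k(n-k) parameters. Given the subspace, invariance makes k(n-k)
coordinates of each matrix, in the basis `graphVec I Y`, determined by the others. The total is
k(n-k) + 2(n² - k(n-k)). -/
theorem ncard_reducibleSet_le {K : Type*} [Field K] [Finite K] {n : ℕ} (I : Finset (Fin n)) :
    (reducibleSet K I).ncard ≤ Nat.card K ^ (2 * n ^ 2 - I.card * (n - I.card)) := by
  classical
  let P := {p : Fin n × Fin n // p.1 ∈ I ∧ p.2 ∉ I}
  let P' := {p : Fin n × Fin n // ¬ (p.1 ∈ I ∧ p.2 ∉ I)}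
  have hmul : ∀ (A B : Matrix (Fin n) (Fin n) K) (Y : P → K)
      (_ : ∀ j ∉ I, A.mulVec (graphVec I Y j) =
        ∑ l ∈ Iᶜ, A.mulVec (graphVec I Y j) l • graphVec I Y l)
      (_ : ∀ j ∉ I, B.mulVec (graphVec I Y j) =
        ∑ l ∈ Iᶜ, B.mulVec (graphVec I Y j) l • graphVec I Y l)
      (_ : ∀ p : P', A.mulVec (graphVec I Y p.1.2) p.1.1 = B.mulVec (graphVec I Y p.1.2) p.1.1),
      A = B := by
    intro A B Y hA hB hAB
    apply Matrix.toLin'.injective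
    refine LinearMap.ext_on_range (span_graphVec I Y) fun j => ?_
    rw [Matrix.toLin'_apply, Matrix.toLin'_apply]
    by_cases hj : j ∈ I
    · ext l
      exact hAB ⟨(l, j), by simp [hj]⟩
    · rw [hA j hj, hB j hj]
      refine Finset.sum_congr rfl fun l hl => ?_
      rw [hAB ⟨(l, j), by simp [Finset.mem_compl.1 hl]⟩]
  let Φ : reducibleSet K I → (P → K) × (Fin 2 → P' → K) := fun x =>
    (x.2.choose, fun i p => (x.1 i).mulVec (graphVec I x.2.choose p.1.2) p.1.1)
  have hΦ : Function.Injective Φ := by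
    intro x x' h
    obtain ⟨h1, h2⟩ := Prod.mk.inj h
    apply Subtype.ext
    funext i
    refine hmul _ _ _ (x.2.choose_spec i) ?_ fun p => ?_
    · rw [h1]
      exact x'.2.choose_spec i
    · have := congrFun (congrFun h2 i) p
      rw [this, h1]
  have hle := Nat.card_le_card_of_injective Φ hΦ
  rw [Nat.card_coe_set_eq] at hle
  have hP : Nat.card P = I.card * (n - I.card) := by
    have : (Finset.univ.filter fun p : Fin n × Fin n => p.1 ∈ I ∧ p.2 ∉ I) = I ×ˢ Iᶜ := by
      ext p; simp
    rw [Nat.card_eq_fintype_card, Fintype.card_subtype, this, Finset.card_product,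
      Finset.card_compl, Fintype.card_fin]
  have hP' : Nat.card P + Nat.card P' = n ^ 2 := by
    rw [Nat.card_eq_fintype_card, Nat.card_eq_fintype_card, Fintype.card_subtype_compl]
    have : Fintype.card P ≤ Fintype.card (Fin n × Fin n) := Fintype.card_subtype_le _
    rw [Nat.add_sub_cancel' this]
    simp [sq]
  refine hle.trans (le_of_eq ?_)
  rw [Nat.card_prod, Nat.card_fun, Nat.card_fun, Nat.card_fun, ← pow_mul, ← pow_add]
  congr 1
  rw [hP] at hP' ⊢
  simp only [Nat.card_eq_fintype_card, Fintype.card_fin] at *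
  omega

/-! ### Counting pairs that commute with a larger field. -/

/-- Pairs of matrices commuting with an endomorphism `c` that has a minimal polynomial of
degree `d` and generates the whole space from the standard basis vectors indexed by `I`. -/
def commutingSet (K : Type*) [Field K] {n : ℕ} (I : Finset (Fin n)) (d : ℕ) :
    Set (Fin 2 → Matrix (Fin n) (Fin n) K) :=
  {x | ∃ c : Module.End K (Fin n → K), (∀ i, Commute c (Matrix.toLin' (x i))) ∧
    (minpoly K c).natDegree = d ∧
    Submodule.span K {w : Fin n → K | ∃ i ∈ I, ∃ p : Polynomial K,
      w = Polynomial.aeval c p (Pi.single i 1)} = ⊤}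

theorem aeval_apply_eq_of_minpoly_eq {K V : Type*} [Field K] [AddCommGroup V] [Module K V]
    [FiniteDimensional K V] {c c' : Module.End K V} (h : minpoly K c = minpoly K c') (v : V)
    (hv : ∀ j < (minpoly K c).natDegree, (c ^ j) v = (c' ^ j) v) (p : Polynomial K) :
    Polynomial.aeval c p v = Polynomial.aeval c' p v := by
  rcases subsingleton_or_nontrivial V with _ | _
  · exact Subsingleton.elim _ _
  have hint : IsIntegral K c := Algebra.IsIntegral.isIntegral c
  have hm := minpoly.monic hint
  have hdeg : (p %ₘ minpoly K c).natDegree < (minpoly K c).natDegree :=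
    Polynomial.natDegree_modByMonic_lt _ hm (minpoly.ne_one K c)
  rw [← Polynomial.aeval_modByMonic_eq_self_of_root (p := p) (minpoly.aeval K c),
    ← Polynomial.aeval_modByMonic_eq_self_of_root (p := p) (q := minpoly K c) (x := c')
      (by rw [h]; exact minpoly.aeval K c'),
    Polynomial.aeval_eq_sum_range' hdeg, Polynomial.aeval_eq_sum_range' hdeg]
  simp only [LinearMap.sum_apply, LinearMap.smul_apply]
  exact Finset.sum_congr rfl fun j hj => by rw [hv j (Finset.mem_range.1 hj)]

/-- The minimal polynomial and the low powers of c on the e_i determine c on a spanning set. A map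
commuting with c is then determined by its values on the e_i. -/
theorem eq_of_commute_of_agree {K : Type*} [Field K] {n : ℕ} {I : Finset (Fin n)}
    {c c' A A' : Module.End K (Fin n → K)} (hm : minpoly K c = minpoly K c')
    (hspan : Submodule.span K {w : Fin n → K | ∃ i ∈ I, ∃ p : Polynomial K,
      w = Polynomial.aeval c p (Pi.single i 1)} = ⊤)
    (hpow : ∀ i ∈ I, ∀ j < (minpoly K c).natDegree,
      (c ^ j) (Pi.single i 1) = (c' ^ j) (Pi.single i 1))
    (hc : Commute c A) (hc' : Commute c' A')
    (hA : ∀ i ∈ I, A (Pi.single i 1) = A' (Pi.single i 1)) : A = A' := by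
  have key : ∀ i ∈ I, ∀ p, Polynomial.aeval c p (Pi.single i 1 : Fin n → K) =
      Polynomial.aeval c' p (Pi.single i 1) :=
    fun i hi p => aeval_apply_eq_of_minpoly_eq hm _ (hpow i hi) p
  have hcc : c = c' := by
    refine LinearMap.ext_on hspan ?_
    rintro _ ⟨i, hi, p, rfl⟩
    have h := key i hi (Polynomial.X * p)
    rw [map_mul, map_mul, Polynomial.aeval_X, Polynomial.aeval_X, Module.End.mul_apply,
      Module.End.mul_apply, ← key i hi p] at h
    exact h
  subst hcc
  refine LinearMap.ext_on hspan ?_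
  rintro _ ⟨i, hi, p, rfl⟩
  have hcomm : ∀ {B : Module.End K (Fin n → K)}, Commute c B →
      Commute (Polynomial.aeval c p) B := by
    intro B hB
    induction p using Polynomial.induction_on' with
    | add p q hp hq => rw [map_add]; exact hp.add_left hq
    | monomial k a =>
      rw [Polynomial.aeval_monomial]
      exact Commute.mul_left (Algebra.commutes a B) (hB.pow_left k)
  have h1 := congrArg (fun f : Module.End K (Fin n → K) => f (Pi.single i 1)) (hcomm hc).eq
  have h2 := congrArg (fun f : Module.End K (Fin n → K) => f (Pi.single i 1)) (hcomm hc').eq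
  simp only [Module.End.mul_apply] at h1 h2
  rw [← h1, ← h2, hA i hi]

theorem ncard_commutingSet_le {K : Type*} [Field K] [Finite K] {n : ℕ} (I : Finset (Fin n))
    (d : ℕ) : (commutingSet K I d).ncard ≤
      Nat.card K ^ (d + n * (I.card * (d - 1)) + 2 * (n * I.card)) := by
  classical
  -- A pair is encoded by the d nonleading coefficients of the minimal polynomial, the vectors c^j
  -- e_i for 1 ≤ j < d (j = 0 carries no information), and the images of the e_i under both
  -- matrices.
  let Φ : commutingSet K I d →
      (Fin d → K) × (I × Fin (d - 1) → Fin n → K) × (Fin 2 → I → Fin n → K) := fun x =>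
    (fun j => (minpoly K x.2.choose).coeff j,
      fun p => (x.2.choose ^ (p.2.1 + 1)) (Pi.single p.1.1 1),
      fun i k => (x.1 i).mulVec (Pi.single k.1 1))
  have hΦ : Function.Injective Φ := by
    intro x x' h
    obtain ⟨h1, h2⟩ := Prod.mk.inj h
    obtain ⟨h2, h3⟩ := Prod.mk.inj h2
    obtain ⟨hc, hd, hspan⟩ := x.2.choose_spec
    obtain ⟨hc', hd', -⟩ := x'.2.choose_spec
    have hm : minpoly K x.2.choose = minpoly K x'.2.choose := by
      ext j
      rcases lt_trichotomy j d with hj | rfl | hj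
      · exact congrFun h1 ⟨j, hj⟩
      · have e1 := (minpoly.monic (Algebra.IsIntegral.isIntegral (R := K) x.2.choose)).coeff_natDegree
        have e2 := (minpoly.monic (Algebra.IsIntegral.isIntegral (R := K) x'.2.choose)).coeff_natDegree
        rw [hd] at e1
        rw [hd'] at e2
        rw [e1, e2]
      · rw [Polynomial.coeff_eq_zero_of_natDegree_lt (by omega),
          Polynomial.coeff_eq_zero_of_natDegree_lt (by omega)]
    apply Subtype.ext
    funext i
    apply Matrix.toLin'.injective
    refine eq_of_commute_of_agree hm hspan ?_ (hc i) (hc' i) ?_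
    · intro k hk j hj
      rcases j with _ | j
      · simp
      · exact congrFun h2 (⟨k, hk⟩, ⟨j, by omega⟩)
    · intro k hk
      exact congrFun (congrFun h3 i) ⟨k, hk⟩
  have hle := Nat.card_le_card_of_injective Φ hΦ
  rw [Nat.card_coe_set_eq] at hle
  refine hle.trans (le_of_eq ?_)
  simp only [Nat.card_prod, Nat.card_fun, ← pow_mul, ← pow_add]
  congr 1
  simp
  ring

/-! ### Bound for nongenerating pairs. -/

theorem not_generating_subset {K : Type*} [Field K] {n : ℕ} [NeZero n] :
    {x : Fin 2 → Matrix (Fin n) (Fin n) K | Algebra.adjoin K (Set.range x) ≠ ⊤} ⊆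
      (⋃ I ∈ Finset.univ.filter fun I : Finset (Fin n) => I.Nonempty ∧ I ≠ Finset.univ,
        reducibleSet K I) ∪
      ⋃ p ∈ (Finset.univ ×ˢ Finset.range (n + 1)).filter
        fun p : Finset (Fin n) × ℕ => 2 ≤ p.2 ∧ p.1.card * p.2 = n, commutingSet K p.1 p.2 := by
  classical
  intro x hx
  have hadj : Algebra.adjoin K (Set.range fun i => Matrix.toLin' (x i)) ≠ ⊤ := by
    intro h
    apply hx
    have h1 : (Algebra.adjoin K (Set.range x)).map
        (Matrix.toLinAlgEquiv' : Matrix (Fin n) (Fin n) K ≃ₐ[K] _).toAlgHom = ⊤ := by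
      rw [AlgHom.map_adjoin, ← Set.range_comp]
      exact h
    rw [eq_top_iff]
    intro m _
    have h2 : Matrix.toLinAlgEquiv' m ∈ (Algebra.adjoin K (Set.range x)).map
        (Matrix.toLinAlgEquiv' : Matrix (Fin n) (Fin n) K ≃ₐ[K] _).toAlgHom := by
      rw [h1]; trivial
    obtain ⟨m', hm', he⟩ := h2
    rwa [← Matrix.toLinAlgEquiv'.injective he]
  rcases exists_invariant_or_commute _ hadj with ⟨W, hbot, htop, hW⟩ | ⟨c, hc, hirr, hdeg⟩
  · left
    obtain ⟨I, h1, h2, h3⟩ := mem_reducibleSet_of_invariant (x := x) hbot htop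
      (fun i w hw => hW _ ⟨i, rfl⟩ w hw)
    simp only [Set.mem_iUnion, Finset.mem_filter, Finset.mem_univ, true_and]
    exact ⟨I, ⟨h1, h2⟩, h3⟩
  · right
    obtain ⟨I, hI, hspan⟩ := exists_finset_span_aeval (fun i : Fin n => (Pi.single i 1 : Fin n → K))
      (by
        rw [← (Pi.basisFun K (Fin n)).span_eq]
        congr 1
        ext; simp) c hirr
    rw [finrank_fin_fun] at hI
    simp only [Set.mem_iUnion, Finset.mem_filter, Finset.mem_univ, true_and, Finset.mem_product,
      Finset.mem_range]
    have hpos : 0 < I.card := Nat.pos_of_ne_zero fun h => by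
      rw [h, zero_mul] at hI
      exact NeZero.ne n hI.symm
    exact ⟨(I, (minpoly K c).natDegree), ⟨by nlinarith, hdeg, hI⟩, c,
      fun i => hc _ ⟨i, rfl⟩, rfl, hspan⟩

/-- Since kd = n, the exponent is n² + nk + d. The bound is attained at n = 3, k = 1, d = 3. -/
theorem commuting_exponent_le {n k d : ℕ} (hn : 3 ≤ n) (hd : 2 ≤ d) (hk : k * d = n) :
    d + n * (k * (d - 1)) + 2 * (n * k) + 3 ≤ 2 * n ^ 2 := by
  obtain ⟨d, rfl⟩ : ∃ d', d = d' + 2 := ⟨d - 2, by omega⟩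
  rw [show d + 2 - 1 = d + 1 from rfl]
  have hk0 : 1 ≤ k := Nat.pos_of_ne_zero fun h => by simp [h] at hk; omega
  rcases Nat.lt_or_ge 1 k with hk1 | hk1
  · subst hk
    have : 4 ≤ k * k := by nlinarith
    nlinarith [Nat.mul_le_mul_right d this, Nat.mul_le_mul_right (d * d) this]
  · obtain rfl : k = 1 := le_antisymm hk1 hk0
    subst hk
    nlinarith

theorem three_le_mul_sub {n k : ℕ} (hn : 3 < n) (hk : 0 < k) (hkn : k < n) :
    3 ≤ k * (n - k) := by
  obtain ⟨l, rfl⟩ := Nat.exists_eq_add_of_lt hkn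
  rw [show k + l + 1 - k = l + 1 by omega]
  nlinarith [Nat.zero_le l]

theorem card_nontrivial_subsets_three :
    (Finset.univ.filter fun I : Finset (Fin 3) => I.Nonempty ∧ I ≠ Finset.univ).card = 6 := by
  decide

theorem ncard_not_generating_le {K : Type*} [Field K] [Finite K] {n : ℕ} (hn : 3 ≤ n) :
    {x : Fin 2 → Matrix (Fin n) (Fin n) K | Algebra.adjoin K (Set.range x) ≠ ⊤}.ncard ≤
      6 * Nat.card K ^ (2 * n ^ 2 - 2) + 2 ^ n * (n + 2) * Nat.card K ^ (2 * n ^ 2 - 3) := by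
  classical
  have : NeZero n := ⟨by omega⟩
  set Q := Nat.card K with hQ
  have hQ1 : 1 ≤ Q := Nat.card_pos
  refine (Set.ncard_le_ncard not_generating_subset (Set.toFinite _)).trans ?_
  refine (Set.ncard_union_le _ _).trans ?_
  have h1 : (⋃ p ∈ (Finset.univ ×ˢ Finset.range (n + 1)).filter
        fun p : Finset (Fin n) × ℕ => 2 ≤ p.2 ∧ p.1.card * p.2 = n, commutingSet K p.1 p.2).ncard ≤
      2 ^ n * (n + 1) * Q ^ (2 * n ^ 2 - 3) := by
    refine (Finset.set_ncard_biUnion_le _ _).trans ?_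
    refine (Finset.sum_le_card_nsmul _ _ (Q ^ (2 * n ^ 2 - 3)) fun p hp => ?_).trans ?_
    · obtain ⟨-, hd, hk⟩ := Finset.mem_filter.1 hp
      refine (ncard_commutingSet_le p.1 p.2).trans (Nat.pow_le_pow_right hQ1 ?_)
      have := commuting_exponent_le hn hd hk
      omega
    · rw [smul_eq_mul]
      gcongr
      refine (Finset.card_filter_le _ _).trans ?_
      simp
  have h2 : (⋃ I ∈ Finset.univ.filter fun I : Finset (Fin n) => I.Nonempty ∧ I ≠ Finset.univ,
        reducibleSet K I).ncard ≤ 6 * Q ^ (2 * n ^ 2 - 2) + 2 ^ n * Q ^ (2 * n ^ 2 - 3) := by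
    refine (Finset.set_ncard_biUnion_le _ _).trans ?_
    have hk : ∀ I : Finset (Fin n), I.Nonempty → I ≠ Finset.univ → 0 < I.card ∧ I.card < n :=
      fun I h h' => ⟨h.card_pos, by simpa using (Finset.card_lt_iff_ne_univ I).2 h'⟩
    -- Only n = 3 produces codimension 2, once for each of the 6 proper nonempty subsets; for n > 3
    -- the codimension is at least 3.
    rcases hn.eq_or_lt with rfl | hn
    · refine le_add_right ?_
      rw [← card_nontrivial_subsets_three]
      refine (Finset.sum_le_card_nsmul _ _ (Q ^ (2 * 3 ^ 2 - 2)) fun I hI => ?_).trans (by simp)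
      refine (ncard_reducibleSet_le I).trans (Nat.pow_le_pow_right hQ1 ?_)
      obtain ⟨-, h, h'⟩ := Finset.mem_filter.1 hI
      obtain ⟨ha, hb⟩ := hk I h h'
      generalize I.card = k at *
      interval_cases k <;> simp
    · refine le_add_left ?_
      refine (Finset.sum_le_card_nsmul _ _ (Q ^ (2 * n ^ 2 - 3)) fun I hI => ?_).trans ?_
      · refine (ncard_reducibleSet_le I).trans (Nat.pow_le_pow_right hQ1 ?_)
        obtain ⟨-, h, h'⟩ := Finset.mem_filter.1 hI
        obtain ⟨ha, hb⟩ := hk I h h'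
        exact Nat.sub_le_sub_left (three_le_mul_sub hn ha hb) _
      · rw [smul_eq_mul]
        gcongr
        refine (Finset.card_filter_le _ _).trans ?_
        simp
  calc _ ≤ _ := add_le_add h2 h1
    _ = _ := by ring

/-! ### Trace fibres and the Galois action on pairs of scalars. -/

theorem ncard_preimage_mul_card_le {G H : Type*} [AddGroup G] [AddGroup H] [Finite G] [Finite H]
    (f : G →+ H) (hf : Function.Surjective f) (P : Set H) :
    (f ⁻¹' P).ncard * Nat.card H ≤ P.ncard * Nat.card G := by
  choose s hs using hf
  have h1 : (f ⁻¹' P).ncard ≤ P.ncard * Nat.card f.ker := by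
    rw [← Nat.card_coe_set_eq, ← Nat.card_coe_set_eq, ← Nat.card_prod]
    refine Nat.card_le_card_of_injective
      (fun x : f ⁻¹' P => ((⟨f x, x.2⟩ : P), (⟨x - s (f x), by
        rw [AddMonoidHom.mem_ker, map_sub, hs, sub_self]⟩ : f.ker))) ?_
    intro x y h
    simp only [Prod.mk.injEq, Subtype.mk.injEq] at h
    rw [h.1] at h
    exact Subtype.ext (sub_left_injective h.2)
  have h2 : Nat.card f.ker * Nat.card H ≤ Nat.card G := by
    rw [← Nat.card_prod]
    refine Nat.card_le_card_of_injective (fun p : f.ker × H => (p.1 : G) + s p.2) ?_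
    rintro ⟨⟨a, ha⟩, b⟩ ⟨⟨a', ha'⟩, b'⟩ h
    have hb : b = b' := by
      have := congrArg f h
      simpa [(AddMonoidHom.mem_ker).1 ha, (AddMonoidHom.mem_ker).1 ha', hs] using this
    subst hb
    simpa using h
  calc _ ≤ P.ncard * Nat.card f.ker * Nat.card H := Nat.mul_le_mul_right _ h1
    _ = P.ncard * (Nat.card f.ker * Nat.card H) := mul_assoc _ _ _
    _ ≤ _ := Nat.mul_le_mul_left _ h2

/-- The traces of a pair of matrices. -/
def tracePair (K : Type*) [Field K] (n : ℕ) : (Fin 2 → Matrix (Fin n) (Fin n) K) →+ (Fin 2 → K) where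
  toFun x i := (x i).trace
  map_zero' := by ext; simp
  map_add' x y := by ext; simp

theorem tracePair_surjective (K : Type*) [Field K] (n : ℕ) [NeZero n] :
    Function.Surjective (tracePair K n) := fun y =>
  ⟨fun i => Matrix.single 0 0 (y i), by ext i; simp [tracePair]⟩

theorem ncard_tracePair_preimage_mul_le {K : Type*} [Field K] [Finite K] {n : ℕ} [NeZero n]
    (P : Set (Fin 2 → K)) : (tracePair K n ⁻¹' P).ncard * Nat.card K ^ 2 ≤
      P.ncard * Nat.card K ^ (2 * n ^ 2) := by
  have h := ncard_preimage_mul_card_le (tracePair K n) (tracePair_surjective K n) P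
  have e : Nat.card (Fin 2 → Matrix (Fin n) (Fin n) K) = Nat.card K ^ (2 * n ^ 2) := by
    rw [Nat.card_fun, Matrix, Nat.card_fun, Nat.card_fun, ← pow_mul, ← pow_mul]
    simp only [Nat.card_eq_fintype_card, Fintype.card_fin]
    congr 1
    ring
  rw [e, Nat.card_fun] at h
  simpa using h

section Galois
variable {F K : Type*} [Field F] [Field K] [Algebra F K] [Finite K]

/-- The fixed field of a nontrivial τ has index at least 2 in K, so its square has at most |K|
elements. -/
theorem ncard_fixed_sq_le {τ : K ≃ₐ[F] K} (hτ : τ ≠ 1) :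
    {y : Fin 2 → K | ∀ i, τ (y i) = y i}.ncard ≤ Nat.card K := by
  have : Finite F := Finite.of_injective _ (algebraMap F K).injective
  let L := IntermediateField.fixedField (Subgroup.zpowers τ)
  have hL : ∀ z : K, τ z = z → z ∈ L := by
    intro z hz
    rw [IntermediateField.mem_fixedField_iff]
    intro f hf
    obtain ⟨k, rfl⟩ := Subgroup.mem_zpowers_iff.1 hf
    have h1 : MulAction.stabilizer (K ≃ₐ[F] K) z ≥ Subgroup.zpowers τ := by
      rw [ge_iff_le, Subgroup.zpowers_le]
      exact hz
    exact h1 hf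
  have hfin : 2 ≤ finrank L K := by
    rw [IntermediateField.finrank_fixedField_eq_card, Nat.card_zpowers]
    have h0 : 0 < orderOf τ := orderOf_pos τ
    have h1 : orderOf τ ≠ 1 := fun h => hτ (orderOf_eq_one_iff.1 h)
    omega
  have hcard : Nat.card K = Nat.card L ^ finrank L K := Module.natCard_eq_pow_finrank
  calc _ ≤ Nat.card (Fin 2 → L) := by
        rw [← Nat.card_coe_set_eq]
        refine Nat.card_le_card_of_injective (fun y i => (⟨y.1 i, hL _ (y.2 i)⟩ : L)) ?_
        intro y y' h
        apply Subtype.ext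
        funext i
        exact congrArg Subtype.val (congrFun h i)
    _ = Nat.card L ^ 2 := by simp [Nat.card_fun]
    _ ≤ _ := by
        rw [hcard]
        exact Nat.pow_le_pow_right Nat.card_pos hfin

theorem ncard_not_free_le : {y : Fin 2 → K | ∃ τ : K ≃ₐ[F] K, τ ≠ 1 ∧ ∀ i, τ (y i) = y i}.ncard ≤
    (finrank F K - 1) * Nat.card K := by
  classical
  have : Finite F := Finite.of_injective _ (algebraMap F K).injective
  have : Fintype (K ≃ₐ[F] K) := Fintype.ofFinite _
  have hsub : {y : Fin 2 → K | ∃ τ : K ≃ₐ[F] K, τ ≠ 1 ∧ ∀ i, τ (y i) = y i} ⊆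
      ⋃ τ ∈ (Finset.univ.erase (1 : K ≃ₐ[F] K)), {y : Fin 2 → K | ∀ i, τ (y i) = y i} := by
    rintro y ⟨τ, hτ, hy⟩
    simp only [Set.mem_iUnion]
    exact ⟨τ, by simpa using hτ, hy⟩
  refine (Set.ncard_le_ncard hsub (Set.toFinite _)).trans ?_
  refine (Finset.set_ncard_biUnion_le _ _).trans ?_
  refine (Finset.sum_le_card_nsmul _ _ (Nat.card K) fun τ hτ =>
    ncard_fixed_sq_le (Finset.ne_of_mem_erase hτ)).trans ?_
  rw [smul_eq_mul, Finset.card_erase_of_mem (Finset.mem_univ _), Finset.card_univ,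
    ← Nat.card_eq_fintype_card, IsGalois.card_aut_eq_finrank]

theorem ncard_orbit_le (y : Fin 2 → K) :
    {z : Fin 2 → K | ∃ τ : K ≃ₐ[F] K, ∀ i, z i = τ (y i)}.ncard ≤ finrank F K := by
  have : Finite F := Finite.of_injective _ (algebraMap F K).injective
  have : {z : Fin 2 → K | ∃ τ : K ≃ₐ[F] K, ∀ i, z i = τ (y i)} =
      Set.range fun (τ : K ≃ₐ[F] K) i => τ (y i) := by
    ext z
    simp [funext_iff, eq_comm]
  rw [this, ← IsGalois.card_aut_eq_finrank F K, ← Nat.card_coe_set_eq]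
  exact Nat.card_le_card_of_surjective _ Set.rangeFactorization_surjective

end Galois

/-! ### Greedy choice of unrelated coordinates. -/

/-- Greedy count of tuples in `G` that are pairwise unrelated by `R`. -/
theorem pow_le_ncard_pairwise_not {α : Type*} [Finite α] (G : Set α) (R : α → α → Prop)
    (hR : ∀ a b, R a b → R b a) (m : ℕ) (hm : ∀ a, {b | R a b}.ncard ≤ m) (t T : ℕ) (htT : t ≤ T) :
    (G.ncard - T * m) ^ t ≤
      {u : Fin t → α | (∀ s, u s ∈ G) ∧ ∀ s s', s ≠ s' → ¬ R (u s) (u s')}.ncard := by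
  classical
  induction t with
  | zero => simp
  | succ t ih =>
    have ih := ih (by omega)
    set S := {u : Fin t → α | (∀ s, u s ∈ G) ∧ ∀ s s', s ≠ s' → ¬ R (u s) (u s')} with hS
    set S' := {u : Fin (t + 1) → α | (∀ s, u s ∈ G) ∧ ∀ s s', s ≠ s' → ¬ R (u s) (u s')} with hS'
    -- `Z u` holds the elements that may be prepended to u. Keeping T fixed while t grows makes the
    -- lower bound on its size the same at every stage.
    let Z : S → Set α := fun u => G \ ⋃ s ∈ (Finset.univ : Finset (Fin t)), {b | R (u.1 s) b}
    have hZ : ∀ u, G.ncard - T * m ≤ (Z u).ncard := by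
      intro u
      have h1 : (⋃ s ∈ (Finset.univ : Finset (Fin t)), {b | R (u.1 s) b}).ncard ≤ T * m := by
        refine (Finset.set_ncard_biUnion_le _ _).trans ?_
        refine (Finset.sum_le_card_nsmul _ _ m fun s _ => hm _).trans ?_
        rw [smul_eq_mul, Finset.card_univ, Fintype.card_fin]
        exact Nat.mul_le_mul_right _ (by omega)
      have h2 := Set.le_ncard_sdiff (⋃ s ∈ (Finset.univ : Finset (Fin t)), {b | R (u.1 s) b}) G
      exact (Nat.sub_le_sub_left h1 _).trans h2
    have hmemZ : ∀ u : S, ∀ z : Z u, z.1 ∈ G ∧ ∀ s, ¬ R (u.1 s) z.1 := by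
      rintro u ⟨z, hz, hz'⟩
      exact ⟨hz, by simpa using hz'⟩
    let Φ : (Σ u : S, Z u) → S' := fun p => ⟨Fin.cons p.2.1 p.1.1, by
      obtain ⟨hz, hz'⟩ := hmemZ p.1 p.2
      obtain ⟨hu, hu'⟩ := p.1.2
      refine ⟨fun s => ?_, fun s s' hss => ?_⟩
      · cases s using Fin.cases with
        | zero => exact hz
        | succ s => exact hu s
      · cases s using Fin.cases with
        | zero =>
          cases s' using Fin.cases with
          | zero => exact absurd rfl hss
          | succ s' => exact fun h => hz' s' (hR _ _ h)
        | succ s =>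
          cases s' using Fin.cases with
          | zero => exact hz' s
          | succ s' => exact hu' s s' (fun h => hss (by rw [h]))⟩
    have hΦ : Function.Injective Φ := by
      rintro ⟨⟨u, hu⟩, ⟨z, hz⟩⟩ ⟨⟨u', hu'⟩, ⟨z', hz'⟩⟩ h
      have h' : (Fin.cons z u : Fin (t + 1) → α) = Fin.cons z' u' := congrArg Subtype.val h
      obtain ⟨h1, h2⟩ := Fin.cons_inj.1 h'
      subst h1 h2
      rfl
    have hle := Nat.card_le_card_of_injective Φ hΦ
    have := Fintype.ofFinite S
    rw [Nat.card_sigma, Nat.card_coe_set_eq] at hle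
    refine le_trans ?_ hle
    calc (G.ncard - T * m) ^ (t + 1) = (G.ncard - T * m) ^ t * (G.ncard - T * m) := pow_succ _ _
      _ ≤ S.ncard * (G.ncard - T * m) := Nat.mul_le_mul_right _ ih
      _ = Fintype.card S • (G.ncard - T * m) := by
        rw [smul_eq_mul, ← Nat.card_coe_set_eq, Nat.card_eq_fintype_card]
      _ ≤ ∑ u : S, Nat.card (Z u) := by
        rw [← Finset.card_univ]
        exact Finset.card_nsmul_le_sum _ _ _ fun u _ => by
          rw [Nat.card_coe_set_eq]; exact hZ u

/-! ### Assembling the estimate. -/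

theorem adjoin_eq_top_of_one {K : Type*} [Field K] (x : Fin 2 → Matrix (Fin 1) (Fin 1) K) :
    Algebra.adjoin K (Set.range x) = ⊤ := by
  rw [eq_top_iff]
  intro m _
  have : m = algebraMap K _ (m 0 0) := by
    ext i j
    rw [Subsingleton.elim i 0, Subsingleton.elim j 0]
    simp [Matrix.algebraMap_eq_diagonal]
  rw [this]
  exact Subalgebra.algebraMap_mem _ _

theorem ncard_not_generating_mul_sq_le {K : Type*} [Field K] [Finite K] {n q : ℕ} (hn : 0 < n)
    (hn2 : n ≠ 2) (hq : 2 ^ n * (n + 2) ≤ q) (hqK : q ≤ Nat.card K) :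
    {x : Fin 2 → Matrix (Fin n) (Fin n) K | Algebra.adjoin K (Set.range x) ≠ ⊤}.ncard * q ^ 2 ≤
      7 * Nat.card K ^ (2 * n ^ 2) := by
  rcases Nat.lt_or_ge n 3 with hn3 | hn3
  · obtain rfl : n = 1 := by omega
    have : {x : Fin 2 → Matrix (Fin 1) (Fin 1) K | Algebra.adjoin K (Set.range x) ≠ ⊤} = ∅ := by
      ext x
      simp [adjoin_eq_top_of_one]
    simp [this]
  · set Q := Nat.card K with hQ
    have hn9 : 3 ≤ 2 * n ^ 2 := by nlinarith
    have e2 : Q ^ (2 * n ^ 2) = Q ^ (2 * n ^ 2 - 2) * Q ^ 2 := by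
      rw [← pow_add]; congr 1; omega
    have e3 : Q ^ (2 * n ^ 2 - 2) = Q ^ (2 * n ^ 2 - 3) * Q := by
      rw [← pow_succ]; congr 1; omega
    have h := ncard_not_generating_le (K := K) hn3
    rw [← hQ] at h
    -- For q this large the lower-order term costs at most one more leading term, giving 7 = 6 + 1.
    have h3 : 2 ^ n * (n + 2) * Q ^ (2 * n ^ 2 - 3) ≤ Q ^ (2 * n ^ 2 - 2) := by
      rw [e3, mul_comm]
      exact Nat.mul_le_mul_left _ (hq.trans hqK)
    calc _ ≤ (7 * Q ^ (2 * n ^ 2 - 2)) * Q ^ 2 :=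
          Nat.mul_le_mul (by omega) (Nat.pow_le_pow_left hqK 2)
      _ = _ := by rw [e2, mul_assoc]

section Main
variable {F K : Type*} [Field F] [Field K] [Algebra F K] [Finite K]

theorem ncard_trace_not_free_mul_sq_le {n q r : ℕ} [NeZero n] (hr : 0 < r) (hrq : r ≤ q)
    (hfin : finrank F K = r) (hK : Nat.card K = q ^ r) :
    (tracePair K n ⁻¹' {y | ∃ τ : K ≃ₐ[F] K, τ ≠ 1 ∧ ∀ i, τ (y i) = y i}).ncard * q ^ 2 ≤
      Nat.card K ^ (2 * n ^ 2) := by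
  set Q := Nat.card K with hQ
  have hQ0 : 0 < Q := Nat.card_pos
  have h := (ncard_tracePair_preimage_mul_le (n := n)
    {y : Fin 2 → K | ∃ τ : K ≃ₐ[F] K, τ ≠ 1 ∧ ∀ i, τ (y i) = y i}).trans
    (Nat.mul_le_mul_right _ (ncard_not_free_le (F := F) (K := K)))
  rw [hfin, ← hQ] at h
  set b := (tracePair K n ⁻¹' {y | ∃ τ : K ≃ₐ[F] K, τ ≠ 1 ∧ ∀ i, τ (y i) = y i}).ncard
  have h' : b * Q ≤ (r - 1) * Q ^ (2 * n ^ 2) := by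
    refine Nat.le_of_mul_le_mul_right ?_ hQ0
    calc b * Q * Q = b * Q ^ 2 := by ring
      _ ≤ _ := h
      _ = _ := by ring
  rcases Nat.lt_or_ge 1 r with hr1 | hr1
  -- For r = 2 this is an equality; for r ≥ 3 it follows from r ≤ q and q³ ≤ Q. For r = 1 there is
  -- no nontrivial automorphism and the set is empty.
  · have hQr : (r - 1) * q ^ 2 ≤ Q := by
      rcases Nat.eq_or_lt_of_le hr1 with rfl | hr2
      · simp [hK]
      · calc (r - 1) * q ^ 2 ≤ q * q ^ 2 := Nat.mul_le_mul_right _ (by omega)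
          _ = q ^ 3 := by ring
          _ ≤ q ^ r := Nat.pow_le_pow_right (by omega) hr2
          _ = Q := hK.symm
    refine Nat.le_of_mul_le_mul_left ?_ (show 0 < r - 1 by omega)
    calc (r - 1) * (b * q ^ 2) = b * ((r - 1) * q ^ 2) := by ring
      _ ≤ b * Q := Nat.mul_le_mul_left _ hQr
      _ ≤ _ := h'
  · obtain rfl : r = 1 := by omega
    have : b = 0 := by
      have : b * Q = 0 := by simpa using h'
      exact (Nat.mul_eq_zero.1 this).resolve_right hQ0.ne'
    simp [this]

theorem ncard_trace_related_mul_sq_le {n q r : ℕ} [NeZero n] (hr : 0 < r) (hrq : r ≤ q)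
    (hfin : finrank F K = r) (hK : Nat.card K = q ^ r) (y : Fin 2 → K) :
    (tracePair K n ⁻¹' {z | ∃ τ : K ≃ₐ[F] K, ∀ i, z i = τ (y i)}).ncard * q ^ 2 ≤
      Nat.card K ^ (2 * n ^ 2) := by
  set Q := Nat.card K with hQ
  have h := (ncard_tracePair_preimage_mul_le (n := n)
    {z : Fin 2 → K | ∃ τ : K ≃ₐ[F] K, ∀ i, z i = τ (y i)}).trans
    (Nat.mul_le_mul_right _ (ncard_orbit_le (F := F) y))
  rw [hfin, ← hQ] at h
  have hQr : r * q ^ 2 ≤ Q ^ 2 := by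
    rw [hK, ← pow_mul]
    rcases Nat.lt_or_ge 1 r with hr1 | hr1
    · calc r * q ^ 2 ≤ q * q ^ 2 := Nat.mul_le_mul_right _ hrq
        _ = q ^ 3 := by ring
        _ ≤ q ^ (r * 2) := Nat.pow_le_pow_right (by omega) (by omega)
    · obtain rfl : r = 1 := by omega
      simp
  refine Nat.le_of_mul_le_mul_left ?_ hr
  calc _ = (tracePair K n ⁻¹' {z | ∃ τ : K ≃ₐ[F] K, ∀ i, z i = τ (y i)}).ncard * (r * q ^ 2) := by
        ring
    _ ≤ _ := Nat.mul_le_mul_left _ hQr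
    _ ≤ _ := h

theorem pow_le_numGen {n t q r : ℕ} (hn : 0 < n) (hn2 : n ≠ 2) (ht : 0 < t) (hr : 0 < r)
    (hrq : r ≤ q) (hnq : 2 ^ n * (n + 2) ≤ q) (hfin : finrank F K = r)
    (hK : Nat.card K = q ^ r) :
    ∃ g : ℕ, (Nat.card K : ℝ) ^ (2 * n ^ 2) * (1 - 25 * t / (q : ℝ) ^ 2) ≤ g ∧
      g ^ t ≤ numGen 2 F (Fin t → Matrix (Fin n) (Fin n) K) := by
  have : NeZero n := ⟨hn.ne'⟩
  let X := Fin 2 → Matrix (Fin n) (Fin n) K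
  set Q := Nat.card K with hQ
  have hq0 : 0 < q := by omega
  have hqQ : q ≤ Q := by rw [hK]; exact Nat.le_self_pow hr.ne' q
  let A : Set X := {x | Algebra.adjoin K (Set.range x) ≠ ⊤}
  let B : Set X := tracePair K n ⁻¹' {y | ∃ τ : K ≃ₐ[F] K, τ ≠ 1 ∧ ∀ i, τ (y i) = y i}
  let G : Set X := (A ∪ B)ᶜ
  let R : X → X → Prop := fun x z => ∃ τ : K ≃ₐ[F] K, ∀ i, tracePair K n z i = τ (tracePair K n x i)
  set m := Q ^ (2 * n ^ 2) / q ^ 2 with hm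
  have hA : A.ncard * q ^ 2 ≤ 7 * Q ^ (2 * n ^ 2) :=
    ncard_not_generating_mul_sq_le hn hn2 hnq hqQ
  have hB : B.ncard * q ^ 2 ≤ Q ^ (2 * n ^ 2) := ncard_trace_not_free_mul_sq_le hr hrq hfin hK
  have hRm : ∀ x, {z | R x z}.ncard ≤ m := fun x =>
    (Nat.le_div_iff_mul_le (by positivity)).2 (ncard_trace_related_mul_sq_le hr hrq hfin hK _)
  have hRsymm : ∀ x z, R x z → R z x := by
    rintro x z ⟨τ, hτ⟩
    exact ⟨τ.symm, fun i => by rw [hτ, AlgEquiv.symm_apply_apply]⟩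
  have hX : Nat.card X = Q ^ (2 * n ^ 2) := by
    rw [Nat.card_fun, Matrix, Nat.card_fun, Nat.card_fun, ← pow_mul, ← pow_mul]
    simp only [Nat.card_eq_fintype_card, Fintype.card_fin]
    congr 1
    ring
  have hG : Q ^ (2 * n ^ 2) ≤ A.ncard + B.ncard + G.ncard := by
    rw [← hX, ← Set.ncard_add_ncard_compl (A ∪ B)]
    exact Nat.add_le_add_right (Set.ncard_union_le A B) _
  -- In units of Q^(2n²)/q² the loss is 7 for `A`, 1 for `B` and t for the greedy step: at most 9t,
  -- well within 25t.
  refine ⟨G.ncard - t * m, ?_, ?_⟩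
  · have hqR : (0 : ℝ) < (q : ℝ) ^ 2 := by positivity
    have hA' : (A.ncard : ℝ) ≤ 7 * (Q : ℝ) ^ (2 * n ^ 2) / (q : ℝ) ^ 2 := by
      rw [le_div_iff₀ hqR]; exact_mod_cast hA
    have hB' : (B.ncard : ℝ) ≤ (Q : ℝ) ^ (2 * n ^ 2) / (q : ℝ) ^ 2 := by
      rw [le_div_iff₀ hqR]; exact_mod_cast hB
    have hm' : (m : ℝ) ≤ (Q : ℝ) ^ (2 * n ^ 2) / (q : ℝ) ^ 2 := by
      rw [le_div_iff₀ hqR]; exact_mod_cast Nat.div_mul_le_self _ _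
    have hG' : (Q : ℝ) ^ (2 * n ^ 2) ≤ A.ncard + B.ncard + G.ncard := by exact_mod_cast hG
    have hsub : (G.ncard : ℝ) ≤ ((G.ncard - t * m : ℕ) : ℝ) + t * m := by
      exact_mod_cast (by omega : G.ncard ≤ G.ncard - t * m + t * m)
    have ht' : (1 : ℝ) ≤ t := by exact_mod_cast ht
    set z := (Q : ℝ) ^ (2 * n ^ 2) / (q : ℝ) ^ 2 with hz
    have hz0 : 0 ≤ z := by positivity
    have e1 : (Q : ℝ) ^ (2 * n ^ 2) * (1 - 25 * t / (q : ℝ) ^ 2) =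
        (Q : ℝ) ^ (2 * n ^ 2) - 25 * t * z := by rw [hz]; ring
    rw [mul_div_assoc, ← hz] at hA'
    have h1 : (t : ℝ) * m ≤ t * z := by gcongr
    have h2 : z ≤ t * z := le_mul_of_one_le_left hz0 ht'
    rw [e1]
    linarith
  · refine (pow_le_ncard_pairwise_not G R hRsymm m hRm t t le_rfl).trans ?_
    rw [numGen, ← Nat.card_coe_set_eq]
    refine Nat.card_le_card_of_injective (fun u => ⟨fun i s => u.1 s i, ?_⟩) ?_
    · obtain ⟨hu, hu'⟩ := u.2
      have hu1 : ∀ s, Algebra.adjoin K (Set.range (u.1 s)) = ⊤ := fun s => by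
        by_contra h
        exact hu s (Or.inl h)
      have hu2 : ∀ s (τ : K ≃ₐ[F] K),
          (∀ i, τ (tracePair K n (u.1 s) i) = tracePair K n (u.1 s) i) → τ = 1 := fun s τ h => by
        by_contra h'
        exact hu s (Or.inr ⟨τ, h', h⟩)
      refine adjoin_eq_top_of_trace _ hu1 ?_
      rintro ⟨s, τ⟩ ⟨s', τ'⟩ h
      have h : ∀ i, τ (tracePair K n (u.1 s) i) = τ' (tracePair K n (u.1 s') i) :=
        fun i => congrFun h i
      -- If s ≠ s', the automorphism τ'⁻¹τ would relate two coordinates chosen unrelated. If s = s',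
      -- it fixes a trace vector with trivial stabilizer, so τ = τ'.
      obtain rfl : s = s' := by
        by_contra hs
        exact hu' s s' hs ⟨τ'⁻¹ * τ, fun i => by
          rw [AlgEquiv.mul_apply, h]; exact (τ'.symm_apply_apply _).symm⟩
      have := hu2 s (τ'⁻¹ * τ) fun i => by
        rw [AlgEquiv.mul_apply, h]; exact τ'.symm_apply_apply _
      rw [inv_mul_eq_one] at this
      rw [this]
    · intro u u' h
      apply Subtype.ext
      funext s i
      exact congrFun (congrFun (congrArg Subtype.val h) i) s

end Main

theorem lemma3p5 (n r t : ℕ) (hn : 0 < n) (hn2 : n ≠ 2) (hr : 0 < r) (ht : 0 < t) :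
    ∃ c : ℕ, ∀ q : ℕ, c ≤ q →
      ∀ (F : Type*) (K : Type*) [Field F] [Field K] [Algebra F K],
        Nat.card F = q → Finite F → Module.finrank F K = r →
          (q : ℝ) ^ (2 * n ^ 2 * r * t) * (1 - 25 * (t : ℝ) / (q : ℝ) ^ 2) ^ t ≤
            (numGen 2 F (Fin t → Matrix (Fin n) (Fin n) K) : ℝ) := by
  -- The first summand absorbs the lower-order terms, the second gives r ≤ q, and the third makes 1
  -- - 25t/q² nonnegative, so that the t-th power is monotone.
  refine ⟨2 ^ n * (n + 2) + r + 25 * t, fun q hq F K _ _ _ hF _ hfin => ?_⟩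
  have : FiniteDimensional F K := Module.finite_of_finrank_pos (hfin ▸ hr)
  have : Finite K := Module.finite_of_finite F
  have hK : Nat.card K = q ^ r := by
    rw [← hF, ← hfin]
    exact Module.natCard_eq_pow_finrank
  obtain ⟨g, hg, hgt⟩ := pow_le_numGen (F := F) (K := K) hn hn2 ht hr (q := q) (by omega) (by omega)
    hfin hK
  have hq1 : (25 * t : ℝ) ≤ q := by exact_mod_cast (by omega : 25 * t ≤ q)
  have hq2 : (1 : ℝ) ≤ q := by exact_mod_cast (by omega : 1 ≤ q)
  have hpos : 0 ≤ 1 - 25 * (t : ℝ) / (q : ℝ) ^ 2 := by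
    rw [sub_nonneg, div_le_one (by positivity)]
    nlinarith
  calc (q : ℝ) ^ (2 * n ^ 2 * r * t) * (1 - 25 * (t : ℝ) / (q : ℝ) ^ 2) ^ t
      = ((Nat.card K : ℝ) ^ (2 * n ^ 2) * (1 - 25 * t / (q : ℝ) ^ 2)) ^ t := by
        rw [mul_pow, hK, Nat.cast_pow, ← pow_mul, ← pow_mul]
        congr 2
        ring
    _ ≤ (g : ℝ) ^ t := by gcongr
    _ ≤ _ := by exact_mod_cast hgt
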